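/- Let $G$ be a discrete group with a length function $|\cdot|\colon G\to[0,\infty)$ (that is, $|e|=0$, $|g^{-1}|=|g|$, $|gh|\le|g|+|h|$). For an integer $k\ge 0$ put $C_k=\{g: k-1<|g|\le k\}$, for real $r,\delta$ put $C_{r,\delta}=\{g: r-\delta\le|g|\le r+\delta\}$, and for $p\in\mathbb N_0$ let $P_p$ be the set of pairs $(a,b)\in G\times G$ with $2p\le|a|+|b|-|ab|<2p+2$. The pair $(G,|\cdot|)$ has *property (J)* if (1) there are $\alpha,\beta,\gamma>0$ and elements $u_{(g,s)}\in C_{s,\alpha}$ ($g\in G$, $s$ real, $0\le s<|g|+1$) such that $v_{(g,s)}:=u_{(g,s)}^{-1}g\in C_{|g|+1-s,\,\beta}$, and such that for all $p\in\mathbb N_0$ and $(a,b)\in P_p$ there is $c\in C_{p,\gamma}$ with $a=u_{(ab,|a|-p)}\,c$ and $b=c^{-1}v_{(ab,|a|-p)}$; and (2) for all $\mu,\nu>0$ there is $N_0\in\mathbb N$ such that for every $b\in G$ and every integer $0\le p\le|b|$ there are at most $N_0$ pairs $(c,v)\in C_{p,\mu}\times C_{|b|-p,\nu}$ with $c^{-1}v=b$.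 Let $G$ act on a C*-algebra $\mathcal A$ by $*$-automorphisms $\alpha_g$. Represent $\mathcal A$ faithfully on a Hilbert space $H$, and realize the reduced crossed product $C^*_r(\mathcal A\rtimes_\alpha G)$ on $\ell^2(G,H)$ by $(a\xi)(h)=\alpha_{h^{-1}}(a)\xi(h)$ and $(L_g\xi)(h)=\xi(g^{-1}h)$. For a finitely supported $Z=\sum_g L_gZ_g$ with $Z_g\in\mathcal A$, let $$\|Z\|_\pi=\Big\|\sum_g (L_gZ_g)^*(L_gZ_g)\Big\|^{1/2}=\Big\|\sum_g Z_g^*Z_g\Big\|^{1/2},\qquad \|Z\|_r=\Big\|\sum_g L_gZ_gZ_g^*L_g^*\Big\|^{1/2}$$ be its column norm and its row norm, and let $M_{\chi_m}*Z=\sum_{g\in C_m}L_gZ_g$. **Statement.** If $(G,|\cdot|)$ has property (J), then there is a constant $N>0$, depending only on $(G,|\cdot|)$, such that for every action of $G$ on a C*-algebra $\mathcal A$ as above, all integers $k,l,m\ge0$ and all finitely supported $X=\sum_a L_aX_a$ with support in $C_k$ and $Y=\sum_b L_bY_b$ with support in $C_l$, $$\|M_{\chi_m}*(XY)\|_\pi\le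 N\Big(\sum_{a\in C_k}\|X_a\|^2\Big)^{1/2}\Big\|\sum_{b\in C_l}Y_b^*Y_b\Big\|^{1/2},$$ $$\|M_{\chi_m}*(XY)\|_r\le N\Big\|\sum_{a\in C_k}L_aX_aX_a^*L_a^*\Big\|^{1/2}\Big(\sum_{b\in C_l}\|Y_b\|^2\Big)^{1/2}.$$ If $G$ is the free group on a set $S$ of any cardinality (in particular, a non-abelian free group) and $|\cdot|$ is the word length with respect to $S$, then both inequalities hold with $N=1$. -/

import Mathlib

open scoped ENNReal

noncomputable section

namespace CrossedRD

/-! ### Length functions and property (J)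

A length function on `G` is a `GroupSeminorm G`: a function `ℓ : G → ℝ` with `ℓ 1 = 0`,
`ℓ (g * h) ≤ ℓ g + ℓ h` and `ℓ g⁻¹ = ℓ g` (so `0 ≤ ℓ g`). -/

section Length

variable {G : Type*} [Group G]

/-- `C_k = {g | k - 1 < |g| ≤ k}`. -/
def shell (ℓ : GroupSeminorm G) (k : ℕ) : Set G :=
  {g | (k : ℝ) - 1 < ℓ g ∧ ℓ g ≤ k}

/-- `C_{r,δ} = {g | r - δ ≤ |g| ≤ r + δ}`. -/
def thickShell (ℓ : GroupSeminorm G) (r δ : ℝ) : Set G :=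
  {g | r - δ ≤ ℓ g ∧ ℓ g ≤ r + δ}

/-- `P_p`: the pairs `(a, b)` whose cancellation number is `p`, that is
`2 p ≤ |a| + |b| - |a b| < 2 p + 2`. -/
def cancelPairs (ℓ : GroupSeminorm G) (p : ℕ) : Set (G × G) :=
  {x | 2 * (p : ℝ) ≤ ℓ x.1 + ℓ x.2 - ℓ (x.1 * x.2) ∧
    ℓ x.1 + ℓ x.2 - ℓ (x.1 * x.2) < 2 * (p : ℝ) + 2}

/-- Property (J) of a group with a length function; `v_{(g,s)}` is `(u g s)⁻¹ * g`. -/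
def PropertyJ (ℓ : GroupSeminorm G) : Prop :=
  (∃ α : ℝ, 0 < α ∧ ∃ β : ℝ, 0 < β ∧ ∃ γ : ℝ, 0 < γ ∧ ∃ u : G → ℝ → G,
    (∀ (g : G) (s : ℝ), 0 ≤ s → s < ℓ g + 1 →
      u g s ∈ thickShell ℓ s α ∧ (u g s)⁻¹ * g ∈ thickShell ℓ (ℓ g + 1 - s) β) ∧
    ∀ (p : ℕ) (a b : G), (a, b) ∈ cancelPairs ℓ p →
      ∃ c ∈ thickShell ℓ p γ,
        a = u (a * b) (ℓ a - p) * c ∧ b = c⁻¹ * ((u (a * b) (ℓ a - p))⁻¹ * (a * b))) ∧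
  ∀ μ : ℝ, 0 < μ → ∀ ν : ℝ, 0 < ν → ∃ N : ℕ, ∀ (b : G) (p : ℕ), (p : ℝ) ≤ ℓ b →
    {x : G × G | x.1 ∈ thickShell ℓ p μ ∧ x.2 ∈ thickShell ℓ (ℓ b - p) ν ∧
      x.1⁻¹ * x.2 = b}.encard ≤ N

open scoped Classical in
/-- The word length on the free group on a set `S` (the length of the reduced word). -/
def freeLength (S : Type*) : GroupSeminorm (FreeGroup S) where
  toFun g := (FreeGroup.norm g : ℝ)
  map_one' := by simp
  mul_le' x y := by exact_mod_cast FreeGroup.norm_mul_le x y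
  inv' x := by simp

end Length

/-! ### The regular representation of a crossed product on `ℓ²(G, H)` -/

section Operators

variable {G : Type*} [Group G] {H : Type*} [NormedAddCommGroup H]

/-- The Hilbert space `ℓ²(G, H) = H ⊗ ℓ²(G)`. -/
abbrev Ell2 (G : Type*) (H : Type*) [NormedAddCommGroup H] : Type _ := lp (fun _ : G => H) 2

theorem memℓp_translate (g : G) (ξ : Ell2 G H) :
    Memℓp (fun h : G => (ξ : G → H) (g⁻¹ * h)) 2 := by
  have h2 : 0 < (2 : ℝ≥0∞).toReal := by simp
  have h1 := (lp.memℓp ξ).summable h2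
  exact memℓp_gen (((Equiv.mulLeft g⁻¹).summable_iff
    (f := fun i => ‖(ξ : G → H) i‖ ^ (2 : ℝ≥0∞).toReal)).2 h1)

variable [InnerProductSpace ℂ H]

/-- The translation operator `(L_g ξ)(h) = ξ(g⁻¹ h)`. -/
def translation (H : Type*) [NormedAddCommGroup H] [InnerProductSpace ℂ H] (g : G) :
    Ell2 G H →L[ℂ] Ell2 G H :=
  LinearMap.mkContinuous
    { toFun := fun ξ => ⟨fun h => (ξ : G → H) (g⁻¹ * h), memℓp_translate g ξ⟩
      map_add' := fun _ _ => rfl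
      map_smul' := fun _ _ => rfl } 1 (by
    intro ξ
    have h2 : 0 < (2 : ℝ≥0∞).toReal := by simp
    rw [one_mul, lp.norm_eq_tsum_rpow h2, lp.norm_eq_tsum_rpow h2]
    exact le_of_eq (congrArg (· ^ (1 / (2 : ℝ≥0∞).toReal))
      ((Equiv.mulLeft g⁻¹).tsum_eq (fun i => ‖(ξ : G → H) i‖ ^ (2 : ℝ≥0∞).toReal))))

@[simp] theorem translation_apply (g : G) (ξ : Ell2 G H) (h : G) :
    (translation H g ξ : G → H) h = (ξ : G → H) (g⁻¹ * h) := rfl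

variable [CompleteSpace H] {A : Type*} [NonUnitalCStarAlgebra A]

/-- The representation of `A` on `ℓ²(G, H)` given by `(a ξ)(h) = π(α_{h⁻¹}(a)) ξ(h)`. -/
def diagRep (α : G →* (A ≃⋆ₐ[ℂ] A)) (π : A →⋆ₙₐ[ℂ] (H →L[ℂ] H)) (a : A) :
    Ell2 G H →L[ℂ] Ell2 G H :=
  lp.mapCLM 2 (fun h : G => π (α h⁻¹ a)) (K := ‖a‖) (norm_nonneg a) (fun h =>
    (NonUnitalStarAlgHom.norm_apply_le π _).trans
      (NonUnitalStarAlgHom.norm_apply_le (α h⁻¹) a))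

@[simp] theorem diagRep_apply (α : G →* (A ≃⋆ₐ[ℂ] A)) (π : A →⋆ₙₐ[ℂ] (H →L[ℂ] H)) (a : A)
    (ξ : Ell2 G H) (h : G) :
    (diagRep α π a ξ : G → H) h = π (α h⁻¹ a) ((ξ : G → H) h) := rfl

/-- The operator `L_g a` on `ℓ²(G, H)`. -/
def monomialOp (α : G →* (A ≃⋆ₐ[ℂ] A)) (π : A →⋆ₙₐ[ℂ] (H →L[ℂ] H)) (g : G) (a : A) :
    Ell2 G H →L[ℂ] Ell2 G H :=
  translation H g * diagRep α π a

/-- The operator `X = ∑ L_g X_g` on `ℓ²(G, H)` with finitely many coefficients `X_g` in `A`.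
The reduced crossed product is the norm closure of the set of these operators. -/
def finSuppOp (α : G →* (A ≃⋆ₐ[ℂ] A)) (π : A →⋆ₙₐ[ℂ] (H →L[ℂ] H)) (X : G →₀ A) :
    Ell2 G H →L[ℂ] Ell2 G H :=
  X.sum fun g a => monomialOp α π g a

end Operators

/-! ### Finitely supported elements: product, multipliers, column and row norm -/

section Elements

variable {G : Type*} [Group G] {A : Type*} [NonUnitalCStarAlgebra A]

/-- The coefficients of the product of `∑ L_a X_a` and `∑ L_b Y_b`, from
`L_a X_a L_b Y_b = L_{ab} α_{b⁻¹}(X_a) Y_b`; `finSuppOp_crossedMul` shows that this is the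
operator product. -/
def crossedMul (α : G →* (A ≃⋆ₐ[ℂ] A)) (X Y : G →₀ A) : G →₀ A :=
  X.sum fun a x => Y.sum fun b y => Finsupp.single (a * b) (α b⁻¹ x * y)

/-- The Hadamard multiplier `M_φ * ∑ L_g Z_g = ∑ L_g φ(g) Z_g`. -/
def hadamard (φ : G → ℂ) (Z : G →₀ A) : G →₀ A :=
  Finsupp.onFinset Z.support (fun g => φ g • Z g) (by
    intro g hg
    rw [Finsupp.mem_support_iff]
    rintro h
    exact hg (by rw [h, smul_zero]))

/-- The characteristic function `χ_m` of `C_m`. -/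
def shellChar (ℓ : GroupSeminorm G) (m : ℕ) : G → ℂ := (shell ℓ m).indicator 1

variable {H : Type*} [NormedAddCommGroup H] [InnerProductSpace ℂ H] [CompleteSpace H]

theorem monomialOp_mul (α : G →* (A ≃⋆ₐ[ℂ] A)) (π : A →⋆ₙₐ[ℂ] (H →L[ℂ] H)) (a b : G) (x y : A) :
    monomialOp α π a x * monomialOp α π b y = monomialOp α π (a * b) (α b⁻¹ x * y) := by
  ext ξ h
  have key : α b ((α b)⁻¹ x) = x := (α b).apply_symm_apply x
  simp [monomialOp, mul_assoc, key]

theorem finSuppOp_crossedMul (α : G →* (A ≃⋆ₐ[ℂ] A)) (π : A →⋆ₙₐ[ℂ] (H →L[ℂ] H))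
    (X Y : G →₀ A) :
    finSuppOp α π (crossedMul α X Y) = finSuppOp α π X * finSuppOp α π Y := by
  have h0 : ∀ g : G, monomialOp α π g (0 : A) = 0 := by
    intro g
    ext ξ h
    simp [monomialOp]
  have hadd : ∀ (g : G) (x y : A), monomialOp α π g (x + y) = monomialOp α π g x + monomialOp α π g y := by
    intro g x y
    ext ξ h
    simp [monomialOp]
  unfold finSuppOp crossedMul
  rw [Finsupp.sum_sum_index h0 hadd]
  simp only [Finsupp.sum]
  rw [Finset.sum_mul]
  refine Finset.sum_congr rfl fun a _ => ?_
  have h1 := Finsupp.sum_sum_index (f := Y) (g := fun b y => Finsupp.single (a * b)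
    (α b⁻¹ (X a) * y)) h0 hadd
  simp only [Finsupp.sum] at h1
  rw [h1, Finset.mul_sum]
  refine Finset.sum_congr rfl fun b _ => ?_
  have h2 := Finsupp.sum_single_index (a := a * b) (b := α b⁻¹ (X a) * Y b) (h0 (a * b))
  simp only [Finsupp.sum] at h2
  rw [h2, monomialOp_mul]

/-- The coefficients of `∑ L_g X_g` are matrix entries of the operator, so that the operator
determines them when `π` is faithful. -/
theorem finSuppOp_single_one [DecidableEq G] (α : G →* (A ≃⋆ₐ[ℂ] A))
    (π : A →⋆ₙₐ[ℂ] (H →L[ℂ] H)) (X : G →₀ A) (g : G) (v : H) :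
    (finSuppOp α π X (lp.single 2 (1 : G) v) : G → H) g = π (X g) v := by
  have h : ∀ (k : G) (a : A), (monomialOp α π k a (lp.single 2 (1 : G) v) : G → H) g
      = if k = g then π a v else 0 := by
    intro k a
    by_cases hk : k = g
    · subst hk
      simp [monomialOp]
    · have hk' : k⁻¹ * g ≠ 1 := fun e => hk (inv_mul_eq_one.1 e)
      simp [monomialOp, hk, hk']
  simp only [finSuppOp, Finsupp.sum, sum_apply, lp.coeFn_sum,
    Finset.sum_apply, h]
  rw [Finset.sum_ite_eq' X.support g]
  split_ifs with hg
  · rfl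
  · rw [Finsupp.notMem_support_iff.1 hg]
    simp

/-- The column norm (`π`-norm) `‖∑_g (L_g Z_g)* (L_g Z_g)‖^{1/2}` of `Z = ∑ L_g Z_g`. -/
def columnNorm (α : G →* (A ≃⋆ₐ[ℂ] A)) (π : A →⋆ₙₐ[ℂ] (H →L[ℂ] H)) (Z : G →₀ A) : ℝ :=
  √‖∑ g ∈ Z.support, star (monomialOp α π g (Z g)) * monomialOp α π g (Z g)‖

/-- The row norm `‖∑_g (L_g Z_g) (L_g Z_g)*‖^{1/2}` of `Z = ∑ L_g Z_g`. -/
def rowNorm (α : G →* (A ≃⋆ₐ[ℂ] A)) (π : A →⋆ₙₐ[ℂ] (H →L[ℂ] H)) (Z : G →₀ A) : ℝ :=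
  √‖∑ g ∈ Z.support, monomialOp α π g (Z g) * star (monomialOp α π g (Z g))‖

/-- The two inequalities with constant `N`, for the action `α` on `A` and the representation `π`:
for all `X` supported in `C_k` and `Y` supported in `C_l`, the column norm of `M_{χ_m} * (XY)` is
at most `N (∑ ‖X_a‖²)^{1/2} ‖∑ Y_b* Y_b‖^{1/2}`, and its row norm is at most
`N ‖∑ L_a X_a X_a* L_a*‖^{1/2} (∑ ‖Y_b‖²)^{1/2}`. -/
def HaagerupInequalities (ℓ : GroupSeminorm G) (α : G →* (A ≃⋆ₐ[ℂ] A))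
    (π : A →⋆ₙₐ[ℂ] (H →L[ℂ] H)) (N : ℝ) : Prop :=
  ∀ (k l m : ℕ) (X Y : G →₀ A), (∀ a, X a ≠ 0 → a ∈ shell ℓ k) → (∀ b, Y b ≠ 0 → b ∈ shell ℓ l) →
    columnNorm α π (hadamard (shellChar ℓ m) (crossedMul α X Y)) ≤
        N * √(∑ a ∈ X.support, ‖X a‖ ^ 2) * √‖∑ b ∈ Y.support, star (Y b) * Y b‖ ∧
    rowNorm α π (hadamard (shellChar ℓ m) (crossedMul α X Y)) ≤
        N * √‖∑ a ∈ X.support, monomialOp α π a (X a) * star (monomialOp α π a (X a))‖ *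
          √(∑ b ∈ Y.support, ‖Y b‖ ^ 2)

end Elements

end CrossedRD

end

/-! Both inequalities reduce to one scalar estimate. Expanding `L_g Z_g η` over the pairs `a b = g`
bounds its norm by the convolution at `g` of `‖X_a‖` with `‖L_b Y_b η‖`; expanding `(L_g Z_g)* η`
gives `‖(L_a X_a)* η‖` and `‖Y_b‖` instead. So it suffices that convolution of functions supported
in `C_k` and `C_l`, cut down to `C_m`, is bounded in `ℓ²` by a constant independent of `k`, `l`, `m`
(`ShellConvolutionBound`). `ShellConvolutionBound.haagerupInequalities` makes this passage.

The scalar estimate is Haagerup's argument. If `a = u c` and `b = c⁻¹ v`, the product `u v` no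
longer involves `c`, so Cauchy–Schwarz in `c` separates the two functions. When `u`, `c`, `v` range
over fixed sets and each of `a`, `b`, `a b` factors in at most `N` ways, the loss is `N ^ 3`
(`sum_sq_convolution_le`). Property (J) supplies such factorisations with bounded multiplicity; in a
free group they are unique, which gives the constant 1. -/

namespace CrossedRD

/-! ### Scalar convolution and counting of factorisations -/

section Scalar

variable {G : Type*} [Group G]

open scoped Classical in
/-- Reindexing the pairs `(x, y)` with equal product and equal left factor `w` by `(x.1, y.2)`. -/
theorem sum_pairs_le (A B : Finset G) (E : Finset (G × G)) (hE : E ⊆ A ×ˢ B) (U C V : Set G)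
    (N : ℕ) (w : G × G → G)
    (hw : ∀ x ∈ E, w x ∈ U ∧ (w x)⁻¹ * x.1 ∈ C ∧ (w x)⁻¹ * (x.1 * x.2) ∈ V)
    (hA : ∀ x ∈ E, {u | u ∈ U ∧ u⁻¹ * x.1 ∈ C}.encard ≤ N)
    (hB : ∀ x ∈ E, {c | c ∈ C ∧ c * x.2 ∈ V}.encard ≤ N)
    (φ : G × G → ℝ) (hφ : ∀ z, 0 ≤ φ z) :
    ∑ z ∈ (E ×ˢ E).filter (fun z => z.1.1 * z.1.2 = z.2.1 * z.2.2 ∧ w z.1 = w z.2),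
      φ (z.1.1, z.2.2) ≤ (N : ℝ) ^ 2 * ∑ z ∈ A ×ˢ B, φ z := by
  set R := (E ×ˢ E).filter (fun z => z.1.1 * z.1.2 = z.2.1 * z.2.2 ∧ w z.1 = w z.2) with hR
  have hmaps : ∀ z ∈ R, (z.1.1, z.2.2) ∈ A ×ˢ B := by
    intro z hz
    simp only [hR, Finset.mem_filter, Finset.mem_product] at hz
    have h1 := Finset.mem_product.1 (hE hz.1.1)
    have h2 := Finset.mem_product.1 (hE hz.1.2)
    exact Finset.mem_product.2 ⟨h1.1, h2.2⟩
  rw [← Finset.sum_fiberwise_of_maps_to hmaps, Finset.mul_sum]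
  refine Finset.sum_le_sum fun ab _ => ?_
  have hcongr : ∑ z ∈ R.filter (fun z => (z.1.1, z.2.2) = ab), φ (z.1.1, z.2.2)
      = (R.filter (fun z => (z.1.1, z.2.2) = ab)).card * φ ab := by
    rw [← nsmul_eq_mul, ← Finset.sum_const]
    exact Finset.sum_congr rfl fun z hz => by rw [(Finset.mem_filter.1 hz).2]
  rw [hcongr]
  refine mul_le_mul_of_nonneg_right ?_ (hφ ab)
  rcases (R.filter (fun z => (z.1.1, z.2.2) = ab)).eq_empty_or_nonempty with h0 | ⟨z₀, hz₀⟩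
  · rw [h0]
    simp only [Finset.card_empty, Nat.cast_zero]
    positivity
  simp only [hR, Finset.mem_filter, Finset.mem_product] at hz₀
  obtain ⟨⟨⟨hx₀, hy₀⟩, -⟩, rfl⟩ := hz₀
  have hUA := hA _ hx₀
  have hCB := hB _ hy₀
  set S := {u | u ∈ U ∧ u⁻¹ * z₀.1.1 ∈ C} with hS
  set T := {c | c ∈ C ∧ c * z₀.2.2 ∈ V} with hT
  have hSf : S.Finite := Set.finite_of_encard_le_coe hUA
  have hTf : T.Finite := Set.finite_of_encard_le_coe hCB
  have hSc : hSf.toFinset.card ≤ N := by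
    rw [hSf.encard_eq_coe_toFinset_card] at hUA
    exact_mod_cast hUA
  have hTc : hTf.toFinset.card ≤ N := by
    rw [hTf.encard_eq_coe_toFinset_card] at hCB
    exact_mod_cast hCB
  have hcard : (R.filter (fun z => (z.1.1, z.2.2) = (z₀.1.1, z₀.2.2))).card
      ≤ (hSf.toFinset ×ˢ hTf.toFinset).card := by
    -- With `x.1` and `y.2` known, the common left factor `u` and `c = u⁻¹ y.1` recover `y.1 = u c`,
    -- and then `x.2` from the common product. There are at most `N` choices for each of `u` and
    -- `c`.
    refine Finset.card_le_card_of_injOn (fun z => (w z.1, (w z.2)⁻¹ * z.2.1)) ?_ ?_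
    · intro z hz
      simp only [hR, Finset.coe_filter, Finset.mem_filter, Finset.mem_product, Set.mem_ofPred_eq,
        Prod.mk.injEq] at hz
      obtain ⟨⟨⟨hx, hy⟩, -, -⟩, h1, h2⟩ := hz
      obtain ⟨hx1, hx2, -⟩ := hw _ hx
      obtain ⟨-, hy2, hy3⟩ := hw _ hy
      simp only [Finset.coe_product, Set.Finite.coe_toFinset, Set.mem_prod]
      refine ⟨⟨hx1, h1 ▸ hx2⟩, hy2, ?_⟩
      rw [← h2, mul_assoc]
      exact hy3
    · intro z hz z' hz' h
      simp only [hR, Finset.coe_filter, Finset.mem_filter, Finset.mem_product, Set.mem_ofPred_eq,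
        Prod.mk.injEq] at hz hz' h
      obtain ⟨⟨-, hm, hwz⟩, h1, h2⟩ := hz
      obtain ⟨⟨-, hm', hwz'⟩, h1', h2'⟩ := hz'
      obtain ⟨hu, hc⟩ := h
      have e21 : z.2.1 = z'.2.1 := by
        rw [← hwz, ← hwz', hu] at hc
        exact mul_left_cancel hc
      have e22 : z.2.2 = z'.2.2 := h2.trans h2'.symm
      have e11 : z.1.1 = z'.1.1 := h1.trans h1'.symm
      have e12 : z.1.2 = z'.1.2 := by
        rw [e21, e22, ← hm', e11] at hm
        exact mul_left_cancel hm
      exact Prod.ext (Prod.ext e11 e12) (Prod.ext e21 e22)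
  rw [Finset.card_product] at hcard
  have : (R.filter (fun z => (z.1.1, z.2.2) = (z₀.1.1, z₀.2.2))).card ≤ N ^ 2 :=
    hcard.trans (by rw [sq]; exact Nat.mul_le_mul hSc hTc)
  exact_mod_cast this

open scoped Classical in
/-- An `ℓ²`-bound for the part of a convolution product that lives on pairs admitting a common
factorisation `a = u c`, `b = c⁻¹ v` with `u ∈ U`, `c ∈ C`, `v ∈ V`, when each of `a`, `b`, `a b`
has at most `N` such factorisations. -/
theorem sum_sq_convolution_le (A B D : Finset G) (U C V : Set G) (N : ℕ)
    (hw : ∀ a ∈ A, ∀ b ∈ B, a * b ∈ D → ∃ u ∈ U, u⁻¹ * a ∈ C ∧ u⁻¹ * (a * b) ∈ V)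
    (hA : ∀ a ∈ A, ∀ b ∈ B, a * b ∈ D → {u | u ∈ U ∧ u⁻¹ * a ∈ C}.encard ≤ N)
    (hB : ∀ a ∈ A, ∀ b ∈ B, a * b ∈ D → {c | c ∈ C ∧ c * b ∈ V}.encard ≤ N)
    (hD : ∀ a ∈ A, ∀ b ∈ B, a * b ∈ D → {u | u ∈ U ∧ u⁻¹ * (a * b) ∈ V}.encard ≤ N)
    (f h : G → ℝ) :
    ∑ g ∈ D, (∑ x ∈ (A ×ˢ B).filter (fun x => x.1 * x.2 = g), f x.1 * h x.2) ^ 2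
      ≤ (N : ℝ) ^ 3 * ((∑ a ∈ A, f a ^ 2) * ∑ b ∈ B, h b ^ 2) := by
  set E := (A ×ˢ B).filter (fun x => x.1 * x.2 ∈ D) with hE
  have hEw : ∀ x : G × G, ∃ u, x ∈ E →
      u ∈ U ∧ u⁻¹ * x.1 ∈ C ∧ u⁻¹ * (x.1 * x.2) ∈ V := by
    intro x
    by_cases hx : x ∈ E
    · have hx' := hx
      simp only [hE, Finset.mem_filter, Finset.mem_product] at hx'
      obtain ⟨u, hu⟩ := hw _ hx'.1.1 _ hx'.1.2 hx'.2
      exact ⟨u, fun _ => hu⟩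
    · exact ⟨1, fun h => absurd h hx⟩
  choose w hw' using hEw
  have key := sum_pairs_le A B E (Finset.filter_subset _ _) U C V N w hw'
    (fun x hx => by
      simp only [hE, Finset.mem_filter, Finset.mem_product] at hx
      exact hA _ hx.1.1 _ hx.1.2 hx.2)
    (fun x hx => by
      simp only [hE, Finset.mem_filter, Finset.mem_product] at hx
      exact hB _ hx.1.1 _ hx.1.2 hx.2)
    (fun z => f z.1 ^ 2 * h z.2 ^ 2) (fun z => by positivity)
  set Ψ : G × G → ℝ := fun x =>
    ∑ y ∈ E.filter (fun y => x.1 * x.2 = y.1 * y.2 ∧ w x = w y), f x.1 ^ 2 * h y.2 ^ 2 with hΨ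
  have hsumΨ : ∑ z ∈ (E ×ˢ E).filter (fun z => z.1.1 * z.1.2 = z.2.1 * z.2.2 ∧ w z.1 = w z.2),
      f z.1.1 ^ 2 * h z.2.2 ^ 2 = ∑ x ∈ E, Ψ x := by
    rw [Finset.sum_filter, Finset.sum_product]
    simp only [hΨ, Finset.sum_filter]
  have hfiber : ∀ g ∈ D, (A ×ˢ B).filter (fun x => x.1 * x.2 = g)
      = E.filter (fun x => x.1 * x.2 = g) := by
    intro g hg
    rw [hE, Finset.filter_filter]
    refine Finset.filter_congr fun x _ => ⟨fun h => ⟨h ▸ hg, h⟩, fun h => h.2⟩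
  have step : ∀ g ∈ D, (∑ x ∈ (A ×ˢ B).filter (fun x => x.1 * x.2 = g), f x.1 * h x.2) ^ 2
      ≤ N * ∑ x ∈ E.filter (fun x => x.1 * x.2 = g), Ψ x := by
    intro g hg
    rw [hfiber g hg]
    set Eg := E.filter (fun x => x.1 * x.2 = g) with hEg
    have hmaps : ∀ x ∈ Eg, w x ∈ Eg.image w := fun x hx => Finset.mem_image_of_mem w hx
    have hcard : ((Eg.image w).card : ℝ) ≤ N := by
      rcases Eg.eq_empty_or_nonempty with h0 | ⟨x₀, hx₀⟩
      · rw [h0]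
        simp
      have hx₁ := hx₀
      simp only [hEg, hE, Finset.mem_filter, Finset.mem_product] at hx₁
      have h1 := hD _ hx₁.1.1.1 _ hx₁.1.1.2 hx₁.1.2
      have h2 : ((Eg.image w : Finset G) : Set G) ⊆
          {u | u ∈ U ∧ u⁻¹ * (x₀.1 * x₀.2) ∈ V} := by
        intro u hu
        obtain ⟨x, hx, rfl⟩ := Finset.mem_image.1 (Finset.mem_coe.1 hu)
        rw [hEg, Finset.mem_filter] at hx
        have := hw' x hx.1
        refine ⟨this.1, ?_⟩
        rw [hx₁.2, ← hx.2]
        exact this.2.2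
      have h3 := (Set.encard_le_encard h2).trans h1
      rw [Set.encard_coe_eq_coe_finsetCard] at h3
      exact_mod_cast h3
    -- Cauchy–Schwarz twice: over the at most `N` left factors occurring for `g`, which costs `N`,
    -- then over the pairs sharing one left factor. The second produces `f` at `x` and `h` at `y`,
    -- the sum that `sum_pairs_le` bounds at the cost of `N ^ 2`.
    rw [← Finset.sum_fiberwise_of_maps_to hmaps, ← Finset.sum_fiberwise_of_maps_to hmaps]
    refine (sq_sum_le_card_mul_sum_sq).trans ?_
    refine mul_le_mul hcard ?_ (Finset.sum_nonneg fun _ _ => sq_nonneg _) (Nat.cast_nonneg _)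
    refine Finset.sum_le_sum fun u _ => ?_
    refine (Finset.sum_mul_sq_le_sq_mul_sq _ _ _).trans (le_of_eq ?_)
    rw [Finset.sum_mul_sum]
    refine Finset.sum_congr rfl fun x hx => ?_
    simp only [hEg, Finset.mem_filter] at hx
    simp only [hΨ, hEg, Finset.filter_filter]
    refine Finset.sum_congr (Finset.filter_congr fun y _ => ?_) fun _ _ => rfl
    rw [hx.1.2, hx.2]
    exact ⟨fun h => ⟨h.1.symm, h.2.symm⟩, fun h => ⟨h.1.symm, h.2.symm⟩⟩
  refine (Finset.sum_le_sum step).trans ?_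
  have hmaps : ∀ x ∈ E, x.1 * x.2 ∈ D := fun x hx => (Finset.mem_filter.1 hx).2
  rw [← Finset.mul_sum, Finset.sum_fiberwise_of_maps_to hmaps, ← hsumΨ]
  refine (mul_le_mul_of_nonneg_left key (Nat.cast_nonneg N)).trans (le_of_eq ?_)
  rw [Finset.sum_mul_sum, Finset.sum_product]
  ring

open scoped Classical in
/-- The scalar inequality `‖χ_m (f * h)‖₂ ≤ M ‖f‖₂ ‖h‖₂` for `f` supported in `C_k` and `h`
supported in `C_l`. -/
def ShellConvolutionBound (ℓ : GroupSeminorm G) (M : ℝ) : Prop :=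
  ∀ (k l m : ℕ) (A B D : Finset G), (∀ a ∈ A, a ∈ shell ℓ k) → (∀ b ∈ B, b ∈ shell ℓ l) →
    (∀ g ∈ D, g ∈ shell ℓ m) → ∀ f h : G → ℝ,
    ∑ g ∈ D, (∑ x ∈ (A ×ˢ B).filter (fun x => x.1 * x.2 = g), f x.1 * h x.2) ^ 2
      ≤ M ^ 2 * ((∑ a ∈ A, f a ^ 2) * ∑ b ∈ B, h b ^ 2)

end Scalar

/-! ### The scalar estimate from property (J) -/

section Groups

/-- Fixing `k`, `l`, `m` leaves only two possible cancellation numbers, `q` and `q + 1`. Slightly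
thicker shells of radii `k - q`, `q`, `l - q` therefore hold the factors of all pairs at once, and
part (2) of property (J) counts the factorisations. -/
theorem PropertyJ.exists_shellConvolutionBound {G : Type*} [Group G] {ℓ : GroupSeminorm G}
    (hJ : PropertyJ ℓ) : ∃ M : ℝ, 0 < M ∧ ShellConvolutionBound ℓ M := by
  obtain ⟨⟨α, hα, β, hβ, γ, hγ, u, hu, hfac⟩, hcount⟩ := hJ
  -- The 3 absorbs the rounding of lengths to shells and of the cancellation number to `q`; the
  -- further 6 below absorbs the shift of centres when counting, the worst case being the
  -- factorisations of `a b`.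
  set δ := α + β + γ + 3 with hδ
  obtain ⟨N, hN⟩ := hcount (δ + 6) (by positivity) (δ + 6) (by positivity)
  refine ⟨(N : ℝ) ^ 3 + 1, by positivity, ?_⟩
  intro k l m A B D hA hB hD f h
  -- Since `|a| + |b| - |a b|` lies strictly between `k + l - m - 2` and `k + l - m + 1`, it lies in
  -- `[2 q, 2 q + 4)`. Where the subtraction truncates, `q = 0` and the triangle inequality gives
  -- the lower bound.
  set q : ℕ := (k + l - m - 2) / 2 with hq
  have hN3 : (N : ℝ) ^ 3 ≤ ((N : ℝ) ^ 3 + 1) ^ 2 := by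
    have : (0 : ℝ) ≤ (N : ℝ) ^ 3 := by positivity
    nlinarith
  refine le_trans ?_ (mul_le_mul_of_nonneg_right hN3
    (mul_nonneg (Finset.sum_nonneg fun _ _ => sq_nonneg _)
      (Finset.sum_nonneg fun _ _ => sq_nonneg _)))
  have basic : ∀ a ∈ A, ∀ b ∈ B, a * b ∈ D →
      (k : ℝ) - 1 < ℓ a ∧ ℓ a ≤ k ∧ (l : ℝ) - 1 < ℓ b ∧ ℓ b ≤ l ∧ (m : ℝ) - 1 < ℓ (a * b) ∧
      ℓ (a * b) ≤ m ∧ 2 * (q : ℝ) ≤ ℓ a + ℓ b - ℓ (a * b) ∧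
      ℓ a + ℓ b - ℓ (a * b) < 2 * (q : ℝ) + 4 ∧ ℓ b ≤ ℓ a + ℓ (a * b) ∧
      ℓ a ≤ ℓ b + ℓ (a * b) := by
    intro a ha b hb hab
    obtain ⟨a1, a2⟩ := hA a ha
    obtain ⟨b1, b2⟩ := hB b hb
    obtain ⟨d1, d2⟩ := hD _ hab
    have t0 := map_mul_le_add ℓ a b
    have t1 : ℓ b ≤ ℓ a + ℓ (a * b) := by
      have := map_mul_le_add ℓ a⁻¹ (a * b)
      rwa [inv_mul_cancel_left, map_inv_eq_map] at this
    have t2 : ℓ a ≤ ℓ b + ℓ (a * b) := by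
      have := map_mul_le_add ℓ (a * b) b⁻¹
      rw [mul_inv_cancel_right, map_inv_eq_map] at this
      linarith
    refine ⟨a1, a2, b1, b2, d1, d2, ?_, ?_, t1, t2⟩
    · rcases le_or_gt (m + 2) (k + l) with hle | hlt
      · have : m + 2 + 2 * q ≤ k + l := by omega
        have : (m : ℝ) + 2 + 2 * q ≤ k + l := by exact_mod_cast this
        linarith
      · have : q = 0 := by omega
        rw [this]
        push_cast
        linarith
    · have : k + l ≤ m + 3 + 2 * q := by omega
      have : (k : ℝ) + l ≤ m + 3 + 2 * q := by exact_mod_cast this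
      linarith
  refine sum_sq_convolution_le A B D (thickShell ℓ ((k : ℝ) - q) δ) (thickShell ℓ q δ)
    (thickShell ℓ ((l : ℝ) - q) δ) N ?_ ?_ ?_ ?_ f h
  · intro a ha b hb hab
    obtain ⟨a1, a2, b1, b2, d1, d2, t1, t2, t3, t4⟩ := basic a ha b hb hab
    set t := ℓ a + ℓ b - ℓ (a * b) with ht
    have htq : ∃ p : ℕ, q ≤ p ∧ p ≤ q + 1 ∧ 2 * (p : ℝ) ≤ t ∧ t < 2 * (p : ℝ) + 2 := by
      rcases lt_or_ge t (2 * (q : ℝ) + 2) with h1 | h1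
      · exact ⟨q, le_rfl, by omega, t1, h1⟩
      · refine ⟨q + 1, by omega, le_rfl, ?_, ?_⟩ <;> push_cast <;> linarith
    obtain ⟨p, hqp, hpq, p1, p2⟩ := htq
    have hqp' : (q : ℝ) ≤ p := by exact_mod_cast hqp
    have hpq' : (p : ℝ) ≤ q + 1 := by exact_mod_cast hpq
    obtain ⟨⟨u1, u2⟩, v1, v2⟩ := hu (a * b) (ℓ a - p) (by linarith) (by linarith)
    obtain ⟨c, ⟨c1, c2⟩, hac, -⟩ := hfac p a b ⟨p1, p2⟩
    have hc : (u (a * b) (ℓ a - p))⁻¹ * a = c := by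
      rw [inv_mul_eq_iff_eq_mul]
      exact hac
    refine ⟨u (a * b) (ℓ a - p), ⟨?_, ?_⟩, ?_, ?_, ?_⟩
    · linarith
    · linarith
    · rw [hc]
      exact ⟨by linarith, by linarith⟩
    · linarith
    · linarith
  · intro a ha b hb hab
    obtain ⟨a1, a2, b1, b2, d1, d2, t1, t2, t3, t4⟩ := basic a ha b hb hab
    -- A factorisation `a = u c` is read as `a⁻¹ = c⁻¹ u⁻¹`, so that the short factor `c` has radius
    -- `q ≤ |a|`.
    refine le_trans ?_ (hN a⁻¹ q (by rw [map_inv_eq_map]; linarith))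
    refine Set.encard_le_encard_of_injOn (f := fun u => (u⁻¹ * a, u⁻¹)) ?_
      (fun x _ y _ h => inv_injective (Prod.ext_iff.1 h).2)
    rintro w ⟨⟨w1, w2⟩, c1, c2⟩
    refine ⟨⟨by linarith, by linarith⟩, ⟨?_, ?_⟩, ?_⟩
    · simp only [map_inv_eq_map]
      linarith
    · simp only [map_inv_eq_map]
      linarith
    · group
  · intro a ha b hb hab
    obtain ⟨a1, a2, b1, b2, d1, d2, t1, t2, t3, t4⟩ := basic a ha b hb hab
    refine le_trans ?_ (hN b q (by linarith))
    refine Set.encard_le_encard_of_injOn (f := fun c => (c, c * b)) ?_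
      (fun x _ y _ h => (Prod.ext_iff.1 h).1)
    rintro c ⟨⟨c1, c2⟩, v1, v2⟩
    refine ⟨⟨by linarith, by linarith⟩, ⟨?_, ?_⟩, ?_⟩
    · simp only
      linarith
    · simp only
      linarith
    · group
  · intro a ha b hb hab
    obtain ⟨a1, a2, b1, b2, d1, d2, t1, t2, t3, t4⟩ := basic a ha b hb hab
    have hqk : q ≤ k := by
      have : (q : ℝ) ≤ k := by linarith
      exact_mod_cast this
    have hd0 : 0 ≤ ℓ (a * b) := apply_nonneg ℓ _
    -- The radius `k - q` of `u` may exceed `|a b|`, where the count is not available; `j` is an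
    -- admissible radius within 4 of it.
    set j := min (k - q) ⌊ℓ (a * b)⌋₊ with hj
    have hjle : (j : ℝ) ≤ ℓ (a * b) :=
      (Nat.cast_le.2 (min_le_right _ _)).trans (Nat.floor_le hd0)
    have hjk : (j : ℝ) ≤ (k : ℝ) - q := by
      rw [← Nat.cast_sub hqk]
      exact Nat.cast_le.2 (min_le_left _ _)
    have hjk' : (k : ℝ) - q - 4 ≤ j := by
      rcases min_choice (k - q) ⌊ℓ (a * b)⌋₊ with h1 | h1
      · rw [hj, h1, Nat.cast_sub hqk]
        linarith
      · rw [hj, h1]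
        have := Nat.lt_floor_add_one (ℓ (a * b))
        linarith
    refine le_trans ?_ (hN (a * b) j hjle)
    refine Set.encard_le_encard_of_injOn (f := fun u => (u⁻¹, u⁻¹ * (a * b))) ?_
      (fun x _ y _ h => inv_injective (Prod.ext_iff.1 h).1)
    rintro w ⟨⟨w1, w2⟩, v1, v2⟩
    refine ⟨⟨?_, ?_⟩, ⟨?_, ?_⟩, ?_⟩
    · simp only [map_inv_eq_map]
      linarith
    · simp only [map_inv_eq_map]
      linarith
    · simp only
      linarith
    · simp only
      linarith
    · group

/-! ### Cancellation and geodesic factorisations in free groups -/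

open FreeGroup in
theorem exists_cancellation {S : Type*} (L₁ L₂ : List (S × Bool)) (h₁ : IsReduced L₁)
    (h₂ : IsReduced L₂) :
    ∃ u c v : List (S × Bool), L₁ = u ++ c ∧ L₂ = invRev c ++ v ∧ IsReduced (u ++ v) := by
  induction L₁ using List.reverseRecOn generalizing L₂ with
  | nil => exact ⟨[], [], L₂, rfl, rfl, h₂⟩
  | append_singleton L x ih =>
    rcases L₂ with _ | ⟨y, L'⟩
    · exact ⟨L ++ [x], [], [], by simp, by simp, by simpa using h₁⟩
    -- The condition says that the adjacent letters do not cancel. Otherwise they are mutually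
    -- inverse, and both are moved into `c`.
    by_cases hxy : x.1 = y.1 → x.2 = y.2
    · refine ⟨L ++ [x], [], y :: L', by simp, by simp, ?_⟩
      rw [List.append_assoc]
      have h3 : IsReduced ([x] ++ (y :: L')) := by
        simpa using ⟨hxy, h₂⟩
      have := IsReduced.append_overlap h₁ h3 (by simp)
      simpa using this
    · obtain ⟨u, c, v, rfl, rfl, huv⟩ := ih L' (h₁.infix ⟨[], [x], by simp⟩)
        (h₂.infix ⟨[y], [], by simp⟩)
      refine ⟨u, c ++ [x], v, by simp, ?_, huv⟩
      push Not at hxy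
      have : y = (x.1, !x.2) := by
        refine Prod.ext hxy.1.symm ?_
        have := hxy.2
        revert this
        cases x.2 <;> cases y.2 <;> simp
      simp [invRev, this]

open FreeGroup in
open scoped Classical in
theorem freeGroup_exists_factor {S : Type*} (a b : FreeGroup S) :
    ∃ u : FreeGroup S, a.norm = u.norm + (u⁻¹ * a).norm ∧
      b.norm = (u⁻¹ * a).norm + (u⁻¹ * (a * b)).norm ∧
      (a * b).norm = u.norm + (u⁻¹ * (a * b)).norm := by
  obtain ⟨u, c, v, ha, hb, huv⟩ := exists_cancellation a.toWord b.toWord isReduced_toWord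
    isReduced_toWord
  have hlen : ∀ L : List (S × Bool), IsReduced L → (mk L).norm = L.length := by
    intro L hL
    rw [FreeGroup.norm, toWord_mk, hL.reduce_eq]
  have hra : IsReduced (u ++ c) := ha ▸ isReduced_toWord
  have hrb : IsReduced (invRev c ++ v) := hb ▸ isReduced_toWord
  have ea : a = mk u * mk c := by
    rw [mul_mk, ← ha, mk_toWord]
  have eb : b = (mk c)⁻¹ * mk v := by
    rw [inv_mk, mul_mk, ← hb, mk_toWord]
  have e1 : (mk u)⁻¹ * a = mk c := by rw [ea]; group
  have e2 : (mk u)⁻¹ * (a * b) = mk v := by rw [ea, eb]; group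
  have e3 : a * b = mk (u ++ v) := by rw [ea, eb, ← mul_mk]; group
  refine ⟨mk u, ?_, ?_, ?_⟩
  · rw [e1, hlen u (hra.infix ⟨[], c, by simp⟩), hlen c (hra.infix ⟨u, [], by simp⟩),
      FreeGroup.norm, ha, List.length_append]
  · rw [e1, e2, hlen c (hra.infix ⟨u, [], by simp⟩),
      hlen v (hrb.infix ⟨invRev c, [], by simp⟩), FreeGroup.norm, hb, List.length_append,
      invRev_length]
  · rw [e2, e3, hlen _ huv, hlen u (hra.infix ⟨[], c, by simp⟩),
      hlen v (hrb.infix ⟨invRev c, [], by simp⟩), List.length_append]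

open FreeGroup in
open scoped Classical in
/-- A geodesic factorisation in the free group is determined by the length of its left factor. -/
theorem freeGroup_eq_of_norm_eq {S : Type*} {g u w : FreeGroup S}
    (hu : u.norm + (u⁻¹ * g).norm = g.norm) (hw : w.norm + (w⁻¹ * g).norm = g.norm)
    (huw : u.norm = w.norm) : u = w := by
  have key : ∀ x : FreeGroup S, x.norm + (x⁻¹ * g).norm = g.norm →
      x.toWord = g.toWord.take (x.norm) := by
    intro x hx
    have h1 := toWord_mul_sublist x (x⁻¹ * g)
    rw [mul_inv_cancel_left] at h1
    -- No length is lost, so nothing cancels: the word of `x` is a prefix of the word of `g`.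
    have h2 := h1.eq_of_length (by rw [List.length_append]; exact hx.symm)
    rw [h2, FreeGroup.norm, List.take_left]
  apply toWord_injective
  rw [key u hu, key w hw, huw]

open scoped Classical in
theorem freeGroup_encard_le_one {S : Type*} (g : FreeGroup S) (i j : ℕ) (h : i + j = g.norm) :
    {u : FreeGroup S | u.norm = i ∧ (u⁻¹ * g).norm = j}.encard ≤ 1 := by
  rw [Set.encard_le_one_iff]
  rintro u w ⟨u1, u2⟩ ⟨w1, w2⟩
  exact freeGroup_eq_of_norm_eq (g := g) (by omega) (by omega) (by omega)

open scoped Classical in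
theorem mem_shell_freeLength {S : Type*} {k : ℕ} {g : FreeGroup S} :
    g ∈ shell (freeLength S) k ↔ g.norm = k := by
  have h : freeLength S g = (g.norm : ℝ) := rfl
  simp only [shell, Set.mem_ofPred_eq, h, Nat.cast_le, sub_lt_iff_lt_add]
  rw [← Nat.cast_add_one, Nat.cast_lt]
  omega

open FreeGroup in
theorem shellConvolutionBound_freeLength (S : Type*) :
    ShellConvolutionBound (freeLength S) 1 := by
  classical
  intro k l m A B D hA hB hD f h
  simp only [mem_shell_freeLength] at hA hB hD
  have basic : ∀ a ∈ A, ∀ b ∈ B, a * b ∈ D →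
      -- `k + l - m` is twice the length of the cancelled part, so for an actual pair the division
      -- is exact and nothing truncates.
      ∃ u : FreeGroup S, u.norm = k - (k + l - m) / 2 ∧ (u⁻¹ * a).norm = (k + l - m) / 2 ∧
        (u⁻¹ * (a * b)).norm = l - (k + l - m) / 2 ∧
        k - (k + l - m) / 2 + (k + l - m) / 2 = k ∧
        (k + l - m) / 2 + (l - (k + l - m) / 2) = l ∧
        k - (k + l - m) / 2 + (l - (k + l - m) / 2) = m := by
    intro a ha b hb hab
    obtain ⟨u, h1, h2, h3⟩ := freeGroup_exists_factor a b
    rw [hA a ha] at h1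
    rw [hB b hb] at h2
    rw [hD _ hab] at h3
    exact ⟨u, by omega, by omega, by omega, by omega, by omega, by omega⟩
  have := sum_sq_convolution_le A B D {u | u.norm = k - (k + l - m) / 2}
    {c | c.norm = (k + l - m) / 2} {v | v.norm = l - (k + l - m) / 2} 1 ?_ ?_ ?_ ?_ f h
  · simpa using this
  · intro a ha b hb hab
    obtain ⟨u, h1, h2, h3, -⟩ := basic a ha b hb hab
    exact ⟨u, h1, h2, h3⟩
  · intro a ha b hb hab
    obtain ⟨-, -, -, -, h1, h2, h3⟩ := basic a ha b hb hab
    exact freeGroup_encard_le_one a _ _ (by rw [hA a ha]; exact h1)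
  · intro a ha b hb hab
    obtain ⟨-, -, -, -, h1, h2, h3⟩ := basic a ha b hb hab
    refine le_trans ?_ (freeGroup_encard_le_one b ((k + l - m) / 2) (l - (k + l - m) / 2)
      (by rw [hB b hb]; exact h2))
    refine Set.encard_le_encard_of_injOn (f := fun c => c⁻¹) ?_ (inv_injective.injOn)
    rintro c ⟨c1, c2⟩
    refine ⟨?_, ?_⟩
    · rw [norm_inv_eq]
      exact c1
    · rw [inv_inv]
      exact c2
  · intro a ha b hb hab
    obtain ⟨-, -, -, -, h1, h2, h3⟩ := basic a ha b hb hab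
    exact freeGroup_encard_le_one (a * b) _ _ (by rw [hD _ hab]; exact h3)

end Groups

/-! ### Column norms as quadratic forms -/

section OperatorBounds

variable {K : Type*} [NormedAddCommGroup K] [InnerProductSpace ℂ K] [CompleteSpace K]

theorem sum_norm_sq_apply_eq {ι : Type*} (s : Finset ι) (T : ι → K →L[ℂ] K) (η : K) :
    ((∑ i ∈ s, ‖T i η‖ ^ 2 : ℝ) : ℂ) = inner ℂ ((∑ i ∈ s, star (T i) * T i) η) η := by
  rw [sum_apply, sum_inner]
  push_cast
  refine Finset.sum_congr rfl fun i _ => ?_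
  rw [Function.comp_apply, ContinuousLinearMap.star_eq_adjoint,
    ContinuousLinearMap.adjoint_inner_left, inner_self_eq_norm_sq_to_K]
  rfl

theorem sum_norm_sq_apply_le {ι : Type*} (s : Finset ι) (T : ι → K →L[ℂ] K) (η : K) :
    ∑ i ∈ s, ‖T i η‖ ^ 2 ≤ ‖∑ i ∈ s, star (T i) * T i‖ * ‖η‖ ^ 2 := by
  have h := congrArg (fun z : ℂ => ‖z‖) (sum_norm_sq_apply_eq s T η)
  simp only [Complex.norm_real, Real.norm_eq_abs] at h
  calc ∑ i ∈ s, ‖T i η‖ ^ 2 ≤ |∑ i ∈ s, ‖T i η‖ ^ 2| := le_abs_self _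
    _ ≤ ‖(∑ i ∈ s, star (T i) * T i) η‖ * ‖η‖ := by
        rw [h]
        exact norm_inner_le_norm _ _
    _ ≤ ‖∑ i ∈ s, star (T i) * T i‖ * ‖η‖ * ‖η‖ := by
        gcongr
        exact ContinuousLinearMap.le_opNorm _ _
    _ = _ := by ring

/-- Cauchy–Schwarz extends the bound from the quadratic form to the sesquilinear form, which is then
tested at `ζ = S η`. -/
theorem norm_sum_star_mul_le {ι : Type*} (s : Finset ι) (T : ι → K →L[ℂ] K) {c : ℝ}
    (hc : 0 ≤ c) (h : ∀ η, ∑ i ∈ s, ‖T i η‖ ^ 2 ≤ c * ‖η‖ ^ 2) :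
    ‖∑ i ∈ s, star (T i) * T i‖ ≤ c := by
  refine ContinuousLinearMap.opNorm_le_bound _ hc fun η => ?_
  set S := ∑ i ∈ s, star (T i) * T i with hS
  have hbil : ∀ ζ, ‖inner ℂ (S η) ζ‖ ≤ c * ‖η‖ * ‖ζ‖ := by
    intro ζ
    have e : inner ℂ (S η) ζ = ∑ i ∈ s, inner ℂ (T i η) (T i ζ) := by
      rw [hS, sum_apply, sum_inner]
      refine Finset.sum_congr rfl fun i _ => ?_
      rw [mul_apply_eq_comp, ContinuousLinearMap.star_eq_adjoint,
        ContinuousLinearMap.adjoint_inner_left]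
    rw [e]
    have h1 : ‖∑ i ∈ s, inner ℂ (T i η) (T i ζ)‖ ≤ ∑ i ∈ s, ‖T i η‖ * ‖T i ζ‖ :=
      (norm_sum_le _ _).trans (Finset.sum_le_sum fun i _ => norm_inner_le_norm _ _)
    refine h1.trans (abs_le_of_sq_le_sq' ?_ (by positivity)).2
    refine (Finset.sum_mul_sq_le_sq_mul_sq _ _ _).trans ?_
    calc _ ≤ (c * ‖η‖ ^ 2) * (c * ‖ζ‖ ^ 2) :=
          mul_le_mul (h η) (h ζ) (Finset.sum_nonneg fun _ _ => sq_nonneg _) (by positivity)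
      _ = _ := by ring
  have h2 := hbil (S η)
  rw [inner_self_eq_norm_sq_to_K] at h2
  simp only [norm_pow, Complex.coe_algebraMap, Complex.norm_real, norm_norm] at h2
  rcases (norm_nonneg (S η)).eq_or_lt with h0 | h0
  · rw [← h0]
    positivity
  · rw [sq] at h2
    exact le_of_mul_le_mul_right h2 h0

end OperatorBounds

/-! ### From scalars to the crossed product -/

section CrossedProduct

theorem norm_translation_le {G : Type*} [Group G] {H : Type*} [NormedAddCommGroup H]
    [InnerProductSpace ℂ H] (g : G) : ‖translation H g‖ ≤ 1 :=
  LinearMap.mkContinuous_norm_le _ zero_le_one _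

variable {G : Type*} [Group G] {A : Type*} [NonUnitalCStarAlgebra A]
  {H : Type*} [NormedAddCommGroup H] [InnerProductSpace ℂ H] [CompleteSpace H]
  (α : G →* (A ≃⋆ₐ[ℂ] A)) (π : A →⋆ₙₐ[ℂ] (H →L[ℂ] H))

theorem norm_diagRep_le (a : A) : ‖diagRep α π a‖ ≤ ‖a‖ :=
  lp.norm_mapCLM_le _ _ _ _

theorem norm_monomialOp_le (g : G) (a : A) : ‖monomialOp α π g a‖ ≤ ‖a‖ :=
  (norm_mul_le _ _).trans <|
    (mul_le_mul (norm_translation_le g) (norm_diagRep_le α π a) (norm_nonneg _)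
      zero_le_one).trans_eq (one_mul _)

theorem star_diagRep (a : A) : star (diagRep α π a) = diagRep α π (star a) := by
  symm
  rw [ContinuousLinearMap.star_eq_adjoint, ContinuousLinearMap.eq_adjoint_iff]
  intro ξ η
  rw [lp.inner_eq_tsum, lp.inner_eq_tsum]
  refine tsum_congr fun h => ?_
  rw [diagRep_apply, diagRep_apply, map_star, map_star, ContinuousLinearMap.star_eq_adjoint,
    ContinuousLinearMap.adjoint_inner_left]

theorem sum_star_diagRep_mul (s : Finset G) (Y : G → A) :
    ∑ b ∈ s, star (diagRep α π (Y b)) * diagRep α π (Y b)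
      = diagRep α π (∑ b ∈ s, star (Y b) * Y b) := by
  ext ξ h
  simp only [star_diagRep, sum_apply, lp.coeFn_sum, Finset.sum_apply, diagRep_apply, map_sum,
    map_mul, mul_apply_eq_comp]

/-- Translations are contractions and can be dropped; what remains is the quadratic form of the
single diagonal operator of `∑ Y_b* Y_b`. -/
theorem sum_norm_sq_monomialOp_le (Y : G →₀ A) (η : Ell2 G H) :
    ∑ b ∈ Y.support, ‖monomialOp α π b (Y b) η‖ ^ 2
      ≤ ‖∑ b ∈ Y.support, star (Y b) * Y b‖ * ‖η‖ ^ 2 := by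
  calc ∑ b ∈ Y.support, ‖monomialOp α π b (Y b) η‖ ^ 2
      ≤ ∑ b ∈ Y.support, ‖diagRep α π (Y b) η‖ ^ 2 := by
        refine Finset.sum_le_sum fun b _ => pow_le_pow_left₀ (norm_nonneg _) ?_ 2
        exact (ContinuousLinearMap.le_of_opNorm_le _ (norm_translation_le b) _).trans_eq
          (one_mul _)
    _ ≤ ‖diagRep α π (∑ b ∈ Y.support, star (Y b) * Y b)‖ * ‖η‖ ^ 2 := by
        rw [← sum_star_diagRep_mul]
        exact sum_norm_sq_apply_le _ _ _
    _ ≤ _ := by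
        gcongr
        exact norm_diagRep_le α π _

open scoped Classical in
theorem crossedMul_apply (X Y : G →₀ A) (g : G) :
    crossedMul α X Y g = ∑ x ∈ (X.support ×ˢ Y.support).filter (fun x => x.1 * x.2 = g),
      α x.2⁻¹ (X x.1) * Y x.2 := by
  simp only [crossedMul, Finsupp.sum, Finsupp.finsetSum_apply, Finsupp.single_apply]
  rw [Finset.sum_filter, Finset.sum_product]

open scoped Classical in
theorem monomialOp_hadamard_crossedMul (ℓ : GroupSeminorm G) (m : ℕ) (X Y : G →₀ A) {g : G}
    (hg : g ∈ shell ℓ m) :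
    monomialOp α π g (hadamard (shellChar ℓ m) (crossedMul α X Y) g)
      = ∑ x ∈ (X.support ×ˢ Y.support).filter (fun x => x.1 * x.2 = g),
          monomialOp α π x.1 (X x.1) * monomialOp α π x.2 (Y x.2) := by
  have h1 : hadamard (shellChar ℓ m) (crossedMul α X Y) g = crossedMul α X Y g := by
    simp [hadamard, shellChar, hg]
  have hadd : ∀ (s : Finset (G × G)) (F : G × G → A),
      monomialOp α π g (∑ x ∈ s, F x) = ∑ x ∈ s, monomialOp α π g (F x) := by
    intro s F
    have h2 : ∀ x y, monomialOp α π g (x + y) = monomialOp α π g x + monomialOp α π g y := by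
      intro x y
      ext ξ h
      simp [monomialOp]
    exact map_sum (AddMonoidHom.mk' (monomialOp α π g) h2) F s
  rw [h1, crossedMul_apply, hadd]
  refine Finset.sum_congr rfl fun x hx => ?_
  rw [monomialOp_mul, (Finset.mem_filter.1 hx).2]

theorem mem_shell_of_mem_support_hadamard {ℓ : GroupSeminorm G} {m : ℕ} {Z : G →₀ A} {g : G}
    (hg : g ∈ (hadamard (shellChar ℓ m) Z).support) : g ∈ shell ℓ m := by
  by_contra h
  rw [Finsupp.mem_support_iff] at hg
  exact hg (by simp [hadamard, shellChar, h])

theorem ShellConvolutionBound.haagerupInequalities {ℓ : GroupSeminorm G} {M : ℝ} (hM : 0 < M)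
    (hb : ShellConvolutionBound ℓ M) : HaagerupInequalities ℓ α π M := by
  classical
  intro k l m X Y hX hY
  set Z := hadamard (shellChar ℓ m) (crossedMul α X Y) with hZ
  have hA : ∀ a ∈ X.support, a ∈ shell ℓ k := fun a ha => hX a (Finsupp.mem_support_iff.1 ha)
  have hB : ∀ b ∈ Y.support, b ∈ shell ℓ l := fun b hb => hY b (Finsupp.mem_support_iff.1 hb)
  have hD : ∀ g ∈ Z.support, g ∈ shell ℓ m := fun g hg => mem_shell_of_mem_support_hadamard hg
  have hconv := hb k l m X.support Y.support Z.support hA hB hD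
  have hsqrt : ∀ p q : ℝ, 0 ≤ p → √(M ^ 2 * (p * q)) = M * √p * √q := by
    intro p q hp
    rw [Real.sqrt_mul (sq_nonneg M), Real.sqrt_sq hM.le, Real.sqrt_mul hp, mul_assoc]
  constructor
  · rw [← hsqrt _ _ (Finset.sum_nonneg fun _ _ => sq_nonneg _)]
    refine Real.sqrt_le_sqrt (norm_sum_star_mul_le _ _ (by positivity) fun η => ?_)
    calc ∑ g ∈ Z.support, ‖monomialOp α π g (Z g) η‖ ^ 2
        ≤ ∑ g ∈ Z.support, (∑ x ∈ (X.support ×ˢ Y.support).filter (fun x => x.1 * x.2 = g),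
            ‖X x.1‖ * ‖monomialOp α π x.2 (Y x.2) η‖) ^ 2 := by
          refine Finset.sum_le_sum fun g hg => pow_le_pow_left₀ (norm_nonneg _) ?_ 2
          rw [hZ, monomialOp_hadamard_crossedMul α π ℓ m X Y (hD g hg), sum_apply]
          refine (norm_sum_le _ _).trans (Finset.sum_le_sum fun x _ => ?_)
          exact ContinuousLinearMap.le_of_opNorm_le _ (norm_monomialOp_le α π _ _) _
      _ ≤ M ^ 2 * ((∑ a ∈ X.support, ‖X a‖ ^ 2) *
            ∑ b ∈ Y.support, ‖monomialOp α π b (Y b) η‖ ^ 2) :=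
          hconv (fun a => ‖X a‖) (fun b => ‖monomialOp α π b (Y b) η‖)
      _ ≤ M ^ 2 * ((∑ a ∈ X.support, ‖X a‖ ^ 2) *
            (‖∑ b ∈ Y.support, star (Y b) * Y b‖ * ‖η‖ ^ 2)) := by
          gcongr
          exact sum_norm_sq_monomialOp_le α π Y η
      _ = _ := by ring
  · rw [← hsqrt _ _ (norm_nonneg _)]
    have hnorm : ∀ (g : G) (a : A) (η : Ell2 G H), ‖star (monomialOp α π g a) η‖ ≤ ‖a‖ * ‖η‖ :=
      fun g a η => ContinuousLinearMap.le_of_opNorm_le _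
        ((norm_star _).trans_le (norm_monomialOp_le α π g a)) η
    have hrow := norm_sum_star_mul_le Z.support (fun g => star (monomialOp α π g (Z g)))
      (c := M ^ 2 * (‖∑ a ∈ X.support, monomialOp α π a (X a) * star (monomialOp α π a (X a))‖ *
        ∑ b ∈ Y.support, ‖Y b‖ ^ 2)) (by positivity) fun η => ?_
    · simp only [star_star] at hrow
      exact Real.sqrt_le_sqrt hrow
    -- The row norm of `X` is already stated for operators on `ℓ²(G, H)`, so no passage back to
    -- norms in `A` is needed.
    have hX' := sum_norm_sq_apply_le X.support (fun a => star (monomialOp α π a (X a))) η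
    simp only [star_star] at hX'
    calc ∑ g ∈ Z.support, ‖star (monomialOp α π g (Z g)) η‖ ^ 2
        ≤ ∑ g ∈ Z.support, (∑ x ∈ (X.support ×ˢ Y.support).filter (fun x => x.1 * x.2 = g),
            ‖star (monomialOp α π x.1 (X x.1)) η‖ * ‖Y x.2‖) ^ 2 := by
          refine Finset.sum_le_sum fun g hg => pow_le_pow_left₀ (norm_nonneg _) ?_ 2
          rw [hZ, monomialOp_hadamard_crossedMul α π ℓ m X Y (hD g hg), star_sum, sum_apply]
          refine (norm_sum_le _ _).trans (Finset.sum_le_sum fun x _ => ?_)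
          rw [star_mul, mul_apply_eq_comp, mul_comm]
          exact hnorm _ _ _
      _ ≤ M ^ 2 * ((∑ a ∈ X.support, ‖star (monomialOp α π a (X a)) η‖ ^ 2) *
            ∑ b ∈ Y.support, ‖Y b‖ ^ 2) :=
          hconv (fun a => ‖star (monomialOp α π a (X a)) η‖) (fun b => ‖Y b‖)
      _ ≤ M ^ 2 * (‖∑ a ∈ X.support, monomialOp α π a (X a) * star (monomialOp α π a (X a))‖ *
            ‖η‖ ^ 2 * ∑ b ∈ Y.support, ‖Y b‖ ^ 2) := by
          gcongr
      _ = _ := by ring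

end CrossedProduct

end CrossedRD

theorem mainTheorem6 :
    (∀ (G : Type*) [Group G] (ℓ : GroupSeminorm G), CrossedRD.PropertyJ ℓ →
      ∃ N : ℝ, 0 < N ∧
        ∀ (A : Type*) [NonUnitalCStarAlgebra A] (H : Type*) [NormedAddCommGroup H]
          [InnerProductSpace ℂ H] [CompleteSpace H] (α : G →* (A ≃⋆ₐ[ℂ] A))
          (π : A →⋆ₙₐ[ℂ] (H →L[ℂ] H)), Function.Injective π →
            CrossedRD.HaagerupInequalities ℓ α π N) ∧
    (∀ (S : Type*) (A : Type*) [NonUnitalCStarAlgebra A] (H : Type*) [NormedAddCommGroup H]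
        [InnerProductSpace ℂ H] [CompleteSpace H] (α : FreeGroup S →* (A ≃⋆ₐ[ℂ] A))
        (π : A →⋆ₙₐ[ℂ] (H →L[ℂ] H)), Function.Injective π →
          CrossedRD.HaagerupInequalities (CrossedRD.freeLength S) α π 1) := by
  refine ⟨fun G _ ℓ hJ => ?_, fun S A _ H _ _ _ α π _ =>
    (CrossedRD.shellConvolutionBound_freeLength S).haagerupInequalities α π one_pos⟩
  obtain ⟨N, hN, hb⟩ := hJ.exists_shellConvolutionBound
  exact ⟨N, hN, fun A _ H _ _ _ α π _ => hb.haagerupInequalities α π hN⟩
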